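/- Let $m\ge n\ge 2$ be integers with $(m,n)\neq(2,2)$, and let $G=G_{m,n}=\langle x,y\mid x^m=y^n\rangle$. Put $s_1=xyx^{-m+1}$, $s_2=x^{m-1}y^{-1}$, $a=x$, $b=yx^{-m+1}$; each of $\mathcal S=\{s_1,s_2\}$ and $\mathcal A=\{a,b\}$ generates $G$. A left ordering of $G$ is a strict total order invariant under left multiplication; its positive cone is $\{g: 1<g\}$. The set $\mathrm{LO}(G)$ of left orderings carries the subspace topology from $\{+,-\}^{G\setminus\{1\}}$ (product of discrete spaces), and a left ordering is isolated if it is an isolated point of $\mathrm{LO}(G)$. Let $\Sigma_{\mathcal S}$ be the set of elements of $G$ represented by a word in $s_1^{\pm1},s_2^{\pm1}$ that either contains $s_1$ and not $s_1^{-1}$, or is a non-empty word in $s_2$ alone (without $s_1^{\pm1}$, $s_2^{-1}$). There are a left ordering $<_D$ of $G$ with positive cone $\Sigma_{\mathcal S}$ (the Dehornoy-like ordering defined by $\mathcal S$) and an isolated left ordering $<_A$ of $G$ whose positive cone is the set of non-empty products of elements of $\mathcal A$. They have the following properties. 1. The $<_D$-convex subgroups of $G$ are exactly $\{1\}$, $\langle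 s_2\rangle$ and $G$. 2. The $<_A$-convex subgroups of $G$ are exactly $\{1\}$, $\langle b\rangle$ and $G$. 3. The Conradian soul of $<_D$ is $\langle s_2\rangle$. 4. The Conradian soul of $<_A$ is $\langle b\rangle$. 5. $<_D$ is an accumulation point in $\mathrm{LO}(G)$ of the set of its conjugates $\{<_D\cdot\, g\}_{g\in G}$; hence $<_D$ is not isolated in $\mathrm{LO}(G)$, and the $\sigma(\mathcal S)$-positive monoid $\Sigma_{\mathcal S}\cup\{1\}$ is not finitely generated. Here a subgroup $H$ is $<$-convex if $h<g<h'$ with $h,h'\in H$, $g\in G$ implies $g\in H$; a left ordering is Conradian if $fg^k>g$ for all positive $f,g$ and all $k\ge2$; the Conradian soul of $<$ is the largest $<$-convex subgroup on which the restriction of $<$ is Conradian; and $<\cdot\, g$ is the left ordering in which $u$ is smaller than $v$ iff $ug<vg$. -/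

import Mathlib

open Topology Filter

/-! ### Left orderings and the space of left orderings -/

/-- A left ordering of a group: a strict total order invariant under left multiplication. -/
@[ext]
structure LeftOrdering (G : Type*) [Group G] where
  lt : G → G → Prop
  irrefl : ∀ g, ¬ lt g g
  trans : ∀ f g h, lt f g → lt g h → lt f h
  total : ∀ g h, lt g h ∨ g = h ∨ lt h g
  mul_left : ∀ f g h, lt g h → lt (f * g) (f * h)

namespace LeftOrdering

variable {G : Type*} [Group G]

/-- The positive cone `{g | 1 < g}`. -/
def pos (o : LeftOrdering G) : Set G := {g | o.lt 1 g}

/-- The signs of the non-trivial elements, as a point of `{+,-}^(G - {1})`. -/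
noncomputable def sign (o : LeftOrdering G) : {g : G // g ≠ 1} → Bool :=
  open Classical in fun g => decide (o.lt 1 (g : G))

/-- The topology of `LO(G)`: the subspace topology from the product `{+,-}^(G - {1})` of
discrete two-point spaces. -/
noncomputable instance : TopologicalSpace (LeftOrdering G) :=
  TopologicalSpace.induced sign inferInstance

/-- An isolated ordering is an isolated point of `LO(G)`. -/
def IsIsolated (o : LeftOrdering G) : Prop := IsOpen ({o} : Set (LeftOrdering G))

/-- The right action of `G` on left orderings: `x < x'` in `o.conj g` iff `x g < x' g` in `o`. -/
def conj (o : LeftOrdering G) (g : G) : LeftOrdering G where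
  lt x x' := o.lt (x * g) (x' * g)
  irrefl x := o.irrefl (x * g)
  trans x y z := o.trans (x * g) (y * g) (z * g)
  total x y := by simpa using o.total (x * g) (y * g)
  mul_left f x y h := by simpa [mul_assoc] using o.mul_left f (x * g) (y * g) h

/-- The restriction of a left ordering to a subgroup. -/
def restrict (o : LeftOrdering G) (H : Subgroup G) : LeftOrdering H where
  lt x y := o.lt (x : G) (y : G)
  irrefl x := o.irrefl (x : G)
  trans x y z := o.trans (x : G) (y : G) (z : G)
  total x y := by simpa using o.total (x : G) (y : G)
  mul_left f x y h := by simpa using o.mul_left (f : G) (x : G) (y : G) h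

/-- A subgroup is convex if it contains everything lying between two of its elements. -/
def IsConvex (o : LeftOrdering G) (H : Subgroup G) : Prop :=
  ∀ h ∈ H, ∀ h' ∈ H, ∀ g : G, o.lt h g → o.lt g h' → g ∈ H

/-- Conradian orderings: `g < f g ^ k` for all positive `f`, `g` and all `k ≥ 2`. -/
def IsConradian (o : LeftOrdering G) : Prop :=
  ∀ f g : G, o.lt 1 f → o.lt 1 g → ∀ k : ℕ, 2 ≤ k → o.lt g (f * g ^ k)

/-- `H` is the Conradian soul: the largest convex subgroup on which the ordering is Conradian. -/
def IsConradianSoul (o : LeftOrdering G) (H : Subgroup G) : Prop :=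
  IsGreatest {K : Subgroup G | o.IsConvex K ∧ (o.restrict K).IsConradian} H

end LeftOrdering

/-! ### Words and the monoids defined by an ordered finite generating set -/

section Words

variable {G : Type*} [Group G] {k : ℕ}

/-- The element represented by a word on `S ∪ S⁻¹`; the letter `(i, true)` stands for `s i` and
`(i, false)` for `(s i)⁻¹`. -/
def wordValue (s : Fin k → G) (w : List (Fin k × Bool)) : G :=
  (w.map fun p => if p.2 then s p.1 else (s p.1)⁻¹).prod

/-- A word is `i`-positive if it contains the letter `s i`, but neither `(s i)⁻¹` nor any
`(s j)^±1` with `j < i`. -/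
def IsPositiveWord (i : Fin k) (w : List (Fin k × Bool)) : Prop :=
  (i, true) ∈ w ∧ (i, false) ∉ w ∧ ∀ j < i, ∀ e : Bool, (j, e) ∉ w

/-- The `σ(S)`-positive elements: those represented by an `i`-positive word for some `i`. -/
def sigmaPositive (s : Fin k → G) : Set G :=
  {g | ∃ (i : Fin k) (w : List (Fin k × Bool)), IsPositiveWord i w ∧ wordValue s w = g}

/-- The word positive elements: those represented by a non-empty product of generators. (A
positive cone does not contain `1`, so the empty word is left out.) -/
def wordPositive (s : Fin k → G) : Set G :=
  (Subsemigroup.closure (Set.range s) : Set G)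

/-- `S` is a generating set and `o` is the Dehornoy-like ordering that it defines. -/
def IsDehornoyLike (s : Fin k → G) (o : LeftOrdering G) : Prop :=
  Subgroup.closure (Set.range s) = ⊤ ∧ o.pos = sigmaPositive s

/-- `A` is a generating set and `o` is the isolated ordering that it defines. -/
def DefinesIsolated (s : Fin k → G) (o : LeftOrdering G) : Prop :=
  Subgroup.closure (Set.range s) = ⊤ ∧ o.pos = wordPositive s ∧ o.IsIsolated

end Words

/-! ### The groups `⟨x, y | x ^ m = y ^ n⟩` -/

/-- The group `⟨x, y | x ^ m = y ^ n⟩`. -/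
abbrev TorusGroup (m n : ℕ) : Type :=
  PresentedGroup
    ({FreeGroup.of 0 ^ m * (FreeGroup.of 1 ^ n)⁻¹} : Set (FreeGroup (Fin 2)))

namespace TorusGroup

variable (m n : ℕ)

def x : TorusGroup m n := PresentedGroup.of 0

def y : TorusGroup m n := PresentedGroup.of 1

def s₁ : TorusGroup m n := x m n * y m n * x m n ^ (-(m : ℤ) + 1)

def s₂ : TorusGroup m n := x m n ^ ((m : ℤ) - 1) * (y m n)⁻¹

def a : TorusGroup m n := x m n

def b : TorusGroup m n := y m n * x m n ^ (-(m : ℤ) + 1)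

/-- The ordered generating set `S = {s₁, s₂}`. -/
def S : Fin 2 → TorusGroup m n := ![s₁ m n, s₂ m n]

/-- The ordered generating set `A = {a, b}`. -/
def A : Fin 2 → TorusGroup m n := ![a m n, b m n]

end TorusGroup

/-!
Since `s₁ = a * b` and `s₂ = b⁻¹`, a word without `s₁⁻¹` can be rewritten as one without `a⁻¹` and
vice versa. So both orderings have the same set `Q` of positive elements outside `⟨b⟩`, namely the
elements with a word containing `a` and not `a⁻¹`; they differ only in the sign of `b`.

* `1 ∉ Q`, because `G` acts on the line by order automorphisms such that `x ^ m = y ^ n` is the unit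
  translation, `b` fixes `1` and `a` moves it to the right.
* Every element or its inverse is a product of `a`s and `b`s, as one reads off the normal form in
  the amalgam of `⟨x⟩` and `⟨y⟩` over the centre, using `y * x = b * x ^ m`.
* The relation can be rewritten as `a = b * a * e * a * b`, where `e` is a product of `a`s and `b`s.
  Hence `a⁻¹ * b⁻¹ * a` and `a * b⁻¹ * a⁻¹` lie in `Q`. This violates the Conradian condition on
  `G`, and it shows that the conjugates of `<_D` by `b ^ i * a * b` differ from `<_D` and converge
  to it.
-/

namespace LeftOrdering

variable {G : Type*} [Group G] (o : LeftOrdering G)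

theorem lt_iff_inv_mul_mem_pos {g h : G} : o.lt g h ↔ g⁻¹ * h ∈ o.pos :=
  ⟨fun hgh => by simpa [pos] using o.mul_left g⁻¹ g h hgh,
    fun hgh => by simpa [pos] using o.mul_left g 1 (g⁻¹ * h) hgh⟩

theorem ext_pos {o o' : LeftOrdering G} (h : o.pos = o'.pos) : o = o' := by
  ext g k
  rw [lt_iff_inv_mul_mem_pos, lt_iff_inv_mul_mem_pos, h]

theorem one_notMem_pos : (1 : G) ∉ o.pos := o.irrefl 1

theorem mul_mem_pos {g h : G} (hg : g ∈ o.pos) (hh : h ∈ o.pos) : g * h ∈ o.pos :=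
  o.trans 1 g (g * h) hg (by simpa using o.mul_left g 1 h hh)

theorem pow_succ_mem_pos {g : G} (hg : g ∈ o.pos) (k : ℕ) : g ^ (k + 1) ∈ o.pos := by
  induction k with
  | zero => simpa using hg
  | succ k ih => rw [pow_succ]; exact o.mul_mem_pos ih hg

theorem inv_mem_pos_of_notMem {g : G} (h1 : g ≠ 1) (hg : g ∉ o.pos) : g⁻¹ ∈ o.pos := by
  rcases o.total 1 g with h | h | h
  · exact absurd h hg
  · exact absurd h.symm h1
  · simpa using (o.lt_iff_inv_mul_mem_pos).1 h

theorem inv_notMem_pos {g : G} (hg : g ∈ o.pos) : g⁻¹ ∉ o.pos := fun h =>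
  o.one_notMem_pos (by simpa using o.mul_mem_pos hg h)

theorem eq_of_pos_subset {o o' : LeftOrdering G} (h : o.pos ⊆ o'.pos) : o = o' := by
  refine ext_pos (h.antisymm fun g hg => by_contra fun hgo => ?_)
  have hg1 : g ≠ 1 := fun h1 => o'.one_notMem_pos (h1 ▸ hg)
  exact o'.inv_notMem_pos hg (h (o.inv_mem_pos_of_notMem hg1 hgo))

theorem mem_pos_conj {g u : G} : u ∈ (o.conj g).pos ↔ g⁻¹ * u * g ∈ o.pos := by
  change o.lt (1 * g) (u * g) ↔ _
  rw [lt_iff_inv_mul_mem_pos, one_mul, mul_assoc]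

/-- The left ordering with a given positive cone: `g < h` iff `g⁻¹ * h` belongs to the cone. -/
def ofCone (P : Set G) (one_notMem : (1 : G) ∉ P) (mul_mem : ∀ g ∈ P, ∀ h ∈ P, g * h ∈ P)
    (total : ∀ g, g ∈ P ∨ g = 1 ∨ g⁻¹ ∈ P) : LeftOrdering G where
  lt g h := g⁻¹ * h ∈ P
  irrefl g := by simpa using one_notMem
  trans f g h hfg hgh := by simpa [mul_assoc] using mul_mem _ hfg _ hgh
  total g h := by simpa [inv_mul_eq_one] using total (g⁻¹ * h)
  mul_left f g h hgh := by simpa [mul_assoc] using hgh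

theorem pos_ofCone (P : Set G) (one_notMem mul_mem total) :
    (ofCone P one_notMem mul_mem total).pos = P := by
  ext g
  simp [ofCone, pos]

theorem closure_subset_pos {F : Set G} (hF : F ⊆ o.pos) :
    (Subsemigroup.closure F : Set G) ⊆ o.pos := fun g hg => by
  induction hg using Subsemigroup.closure_induction with
  | mem x hx => exact hF hx
  | mul x y _ _ hx hy => exact o.mul_mem_pos hx hy

theorem mem_pos_of_mem_closure {F : Set G} (hF : F ⊆ o.pos) {g : G}
    (hg : g ∈ Submonoid.closure F) (hg1 : g ≠ 1) : g ∈ o.pos := by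
  rw [← SetLike.mem_coe, Submonoid.closure_eq_one_union] at hg
  exact o.closure_subset_pos hF (hg.resolve_left hg1)

theorem pos_eq_wordPositive {k : ℕ} {s : Fin k → G} (hs : ∀ i, s i ∈ o.pos)
    (htot : ∀ g, g ∈ Submonoid.closure (Set.range s) ∨ g⁻¹ ∈ Submonoid.closure (Set.range s)) :
    o.pos = wordPositive s := by
  have hrange : Set.range s ⊆ o.pos := Set.range_subset_iff.2 hs
  refine Set.Subset.antisymm (fun g hg => ?_) (o.closure_subset_pos hrange)
  have hg1 : g ≠ 1 := fun h => o.one_notMem_pos (h ▸ hg)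
  rcases htot g with h | h
  · rw [← SetLike.mem_coe, Submonoid.closure_eq_one_union] at h
    exact h.resolve_left hg1
  · exact absurd (o.mem_pos_of_mem_closure hrange h (inv_ne_one.2 hg1)) (o.inv_notMem_pos hg)

/-! ### The topology of the space of left orderings -/

theorem sign_eq_true {g : {g : G // g ≠ 1}} : o.sign g = true ↔ (g : G) ∈ o.pos := by
  simp [sign, pos]

theorem continuous_sign : Continuous (sign : LeftOrdering G → {g : G // g ≠ 1} → Bool) :=
  continuous_induced_dom

theorem isOpen_setOf_mem_pos (g : G) : IsOpen {o : LeftOrdering G | g ∈ o.pos} := by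
  rcases eq_or_ne g 1 with rfl | hg
  · simp only [one_notMem_pos, Set.ofPred_false, isOpen_empty]
  · have hpre : {o : LeftOrdering G | g ∈ o.pos} = (fun o => o.sign ⟨g, hg⟩) ⁻¹' {true} := by
      ext o
      simp [sign_eq_true]
    rw [hpre]
    exact (isOpen_discrete _).preimage ((continuous_apply _).comp continuous_sign)

theorem tendsto_nhds_of_eventually_mem_pos {ι : Type*} {l : Filter ι} {u : ι → LeftOrdering G}
    (h : ∀ g ∈ o.pos, ∀ᶠ i in l, g ∈ (u i).pos) : Tendsto u l (𝓝 o) := by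
  rw [nhds_induced, tendsto_comap_iff, tendsto_pi_nhds]
  refine fun g => tendsto_nhds_of_eventually_eq ?_
  by_cases hg : (g : G) ∈ o.pos
  · filter_upwards [h g hg] with i hi
    exact ((u i).sign_eq_true.2 hi).trans (o.sign_eq_true.2 hg).symm
  · filter_upwards [h _ (o.inv_mem_pos_of_notMem g.2 hg)] with i hi
    have hgi : (g : G) ∉ (u i).pos := fun hgi => (u i).inv_notMem_pos hgi hi
    rw [← sign_eq_true, Bool.not_eq_true] at hg hgi
    exact hgi.trans hg.symm

theorem isIsolated_of_finite {F : Set G} (hF : F.Finite) (hpos : F ⊆ o.pos)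
    (hgen : o.pos ⊆ Submonoid.closure F) : o.IsIsolated := by
  have hinter : ({o} : Set (LeftOrdering G)) = ⋂ g ∈ F, {o' | g ∈ o'.pos} := by
    ext o'
    simp only [Set.mem_singleton_iff, Set.mem_iInter, Set.mem_ofPred_eq]
    refine ⟨fun h g hg => h ▸ hpos hg, fun h => (eq_of_pos_subset fun g hg => ?_).symm⟩
    exact o'.mem_pos_of_mem_closure h (hgen hg) fun h1 => o.one_notMem_pos (h1 ▸ hg)
  rw [IsIsolated, hinter]
  exact hF.isOpen_biInter fun g _ => isOpen_setOf_mem_pos g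

theorem isIsolated_of_pos_eq_wordPositive {k : ℕ} {s : Fin k → G}
    (hpos : o.pos = wordPositive s) : o.IsIsolated := by
  refine o.isIsolated_of_finite (Set.finite_range s) ?_ ?_ <;> rw [hpos, wordPositive]
  · exact Subsemigroup.subset_closure
  · rw [Submonoid.closure_eq_one_union]
    exact Set.subset_union_right

theorem not_fg_closure_pos (h : ¬ o.IsIsolated) : ¬ (Submonoid.closure o.pos).FG := by
  rintro ⟨F, hF⟩
  refine h (o.isIsolated_of_finite (F := (F : Set G) \ {1}) F.finite_toSet.sdiff ?_ ?_)
  · rintro g ⟨hg, hg1⟩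
    exact o.mem_pos_of_mem_closure subset_rfl (hF ▸ Submonoid.subset_closure hg) hg1
  · rw [Submonoid.closure_sdiff_singleton_one, hF]
    exact Submonoid.subset_closure

theorem not_isIsolated_of_accPt {C : Set (LeftOrdering G)} (h : AccPt o (𝓟 C)) :
    ¬ o.IsIsolated := by
  rw [IsIsolated, isOpen_singleton_iff_punctured_nhds]
  exact (NeBot.mono h inf_le_left).ne

/-! ### Convex subgroups and the Conradian soul -/

variable {o} {H K : Subgroup G}

theorem isConvex_bot : o.IsConvex ⊥ := by
  intro h hh h' hh' g hg hg'
  rw [Subgroup.mem_bot] at hh hh'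
  subst hh hh'
  exact absurd (o.trans _ _ _ hg hg') (o.irrefl 1)

theorem isConvex_top : o.IsConvex ⊤ := fun _ _ _ _ _ _ _ => Subgroup.mem_top _

theorem IsConvex.mem (hH : o.IsConvex H) {g h : G} (hh : h ∈ H) (hg : g ∈ o.pos)
    (hgh : g⁻¹ * h ∈ o.pos) : g ∈ H :=
  hH 1 H.one_mem h hh g hg (o.lt_iff_inv_mul_mem_pos.2 hgh)

theorem exists_mem_pos_of_ne_bot (hH : H ≠ ⊥) : ∃ g ∈ H, g ∈ o.pos := by
  obtain ⟨g, hg, hg1⟩ := H.bot_or_exists_ne_one.resolve_left hH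
  by_cases hpos : g ∈ o.pos
  · exact ⟨g, hg, hpos⟩
  · exact ⟨g⁻¹, H.inv_mem hg, o.inv_mem_pos_of_notMem hg1 hpos⟩

theorem IsConvex.mem_of_isLeast_pos (hH : o.IsConvex H) (hbot : H ≠ ⊥) {b : G} (hb : b ∈ o.pos)
    (hleast : ∀ g ∈ o.pos, g = b ∨ b⁻¹ * g ∈ o.pos) : b ∈ H := by
  obtain ⟨g, hgH, hg⟩ := exists_mem_pos_of_ne_bot (o := o) hbot
  rcases hleast g hg with rfl | hbg
  · exact hgH
  · exact hH.mem hgH hb hbg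

theorem isConradian [IsMulCommutative G] (o : LeftOrdering G) : o.IsConradian := by
  intro f g hf hg k hk
  obtain ⟨i, rfl⟩ := Nat.exists_eq_add_of_le' hk
  have hmul : g⁻¹ * (f * g ^ (i + 2)) = f * g ^ (i + 1) := by
    rw [pow_succ' g (i + 1), ← mul_assoc f, mul_comm' f g, mul_assoc, inv_mul_cancel_left]
  rw [lt_iff_inv_mul_mem_pos, hmul]
  exact o.mul_mem_pos hf (o.pow_succ_mem_pos hg i)

theorem isConradianSoul_of_isConvex_iff
    (hconv : ∀ K : Subgroup G, o.IsConvex K ↔ K = ⊥ ∨ K = H ∨ K = ⊤)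
    (hH : (o.restrict H).IsConradian) (ho : ¬ o.IsConradian) : o.IsConradianSoul H := by
  refine ⟨⟨(hconv H).2 (.inr (.inl rfl)), hH⟩, ?_⟩
  rintro K ⟨hK, hKC⟩
  rcases (hconv K).1 hK with rfl | rfl | rfl
  · exact bot_le
  · exact le_rfl
  · exact absurd (fun f g hf hg => hKC ⟨f, trivial⟩ ⟨g, trivial⟩ hf hg) ho

end LeftOrdering

/-! ### Orderings with a convex cyclic subgroup -/

/-- `Q` is the set of positive elements outside the convex subgroup `⟨b⟩ ≅ ℤ` for some left
ordering: a subsemigroup that is stable under multiplication by powers of `b` and such that the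
group is the disjoint union of `Q`, `Q⁻¹` and `⟨b⟩`. -/
structure IsRelCone {G : Type*} [Group G] (Q : Set G) (b : G) : Prop where
  mul_mem : ∀ g ∈ Q, ∀ h ∈ Q, g * h ∈ Q
  zpow_mul_mem : ∀ (k : ℤ), ∀ g ∈ Q, b ^ k * g ∈ Q
  mul_zpow_mem : ∀ (k : ℤ), ∀ g ∈ Q, g * b ^ k ∈ Q
  one_notMem : (1 : G) ∉ Q
  trichotomy : ∀ g : G, g ∈ Q ∨ g⁻¹ ∈ Q ∨ g ∈ Subgroup.zpowers b
  not_isOfFinOrder : ¬ IsOfFinOrder b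

/-- The positive cone of the ordering in which the elements of `Q` and `b` are positive. -/
def relCone {G : Type*} [Group G] (Q : Set G) (b : G) : Set G :=
  Q ∪ Set.range fun k : ℕ => b ^ (k + 1)

namespace IsRelCone

variable {G : Type*} [Group G] {Q : Set G} {b : G}

theorem inv (hQ : IsRelCone Q b) : IsRelCone Q b⁻¹ where
  mul_mem := hQ.mul_mem
  zpow_mul_mem k g hg := by simpa using hQ.zpow_mul_mem (-k) g hg
  mul_zpow_mem k g hg := by simpa using hQ.mul_zpow_mem (-k) g hg
  one_notMem := hQ.one_notMem
  trichotomy := by simpa using hQ.trichotomy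
  not_isOfFinOrder := by simpa using hQ.not_isOfFinOrder

theorem zpow_notMem (hQ : IsRelCone Q b) (k : ℤ) : b ^ k ∉ Q := fun h =>
  hQ.one_notMem (by simpa using hQ.zpow_mul_mem (-k) _ h)

theorem one_notMem_relCone (hQ : IsRelCone Q b) : (1 : G) ∉ relCone Q b := by
  rintro (h | ⟨k, hk⟩)
  · exact hQ.one_notMem h
  · exact hQ.not_isOfFinOrder (isOfFinOrder_iff_pow_eq_one.2 ⟨k + 1, k.succ_pos, hk⟩)

theorem mul_mem_relCone (hQ : IsRelCone Q b) :
    ∀ g ∈ relCone Q b, ∀ h ∈ relCone Q b, g * h ∈ relCone Q b := by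
  rintro g (hg | ⟨k, rfl⟩) h (hh | ⟨l, rfl⟩)
  · exact .inl (hQ.mul_mem _ hg _ hh)
  · exact .inl (by simpa only [zpow_natCast] using hQ.mul_zpow_mem (l + 1 : ℕ) _ hg)
  · exact .inl (by simpa only [zpow_natCast] using hQ.zpow_mul_mem (k + 1 : ℕ) _ hh)
  · exact .inr ⟨k + l + 1, by dsimp only; rw [← pow_add]; congr 1; omega⟩

theorem mem_relCone_or_eq_one_or_inv_mem (hQ : IsRelCone Q b) (g : G) :
    g ∈ relCone Q b ∨ g = 1 ∨ g⁻¹ ∈ relCone Q b := by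
  rcases hQ.trichotomy g with h | h | ⟨k, rfl⟩
  · exact .inl (.inl h)
  · exact .inr (.inr (.inl h))
  · rcases k with (_ | k) | k
    · exact .inr (.inl (by simp))
    · exact .inl (.inr ⟨k, (zpow_natCast b (k + 1)).symm⟩)
    · exact .inr (.inr (.inr ⟨k, by simp⟩))

/-- The left ordering with positive cone `relCone Q b`. -/
def ordering (hQ : IsRelCone Q b) : LeftOrdering G :=
  .ofCone (relCone Q b) hQ.one_notMem_relCone hQ.mul_mem_relCone
    hQ.mem_relCone_or_eq_one_or_inv_mem

theorem pos_ordering (hQ : IsRelCone Q b) : hQ.ordering.pos = relCone Q b :=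
  LeftOrdering.pos_ofCone _ _ _ _

theorem mem_pos_of_mem (hQ : IsRelCone Q b) {g : G} (hg : g ∈ Q) : g ∈ hQ.ordering.pos :=
  hQ.pos_ordering ▸ .inl hg

theorem base_mem_pos (hQ : IsRelCone Q b) : b ∈ hQ.ordering.pos :=
  hQ.pos_ordering ▸ .inr ⟨0, by simp⟩

theorem eq_base_or_inv_mul_mem_pos (hQ : IsRelCone Q b) {g : G} (hg : g ∈ hQ.ordering.pos) :
    g = b ∨ b⁻¹ * g ∈ hQ.ordering.pos := by
  rw [pos_ordering] at hg ⊢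
  rcases hg with hg | ⟨_ | k, rfl⟩
  · exact .inr (.inl (by simpa using hQ.zpow_mul_mem (-1) g hg))
  · exact .inl (by simp)
  · exact .inr (.inr ⟨k, by simp [pow_succ' b (k + 1)]⟩)

theorem isConvex_zpowers (hQ : IsRelCone Q b) : hQ.ordering.IsConvex (Subgroup.zpowers b) := by
  rintro _ ⟨k, rfl⟩ _ ⟨l, rfl⟩ g hkg hgl
  rw [LeftOrdering.lt_iff_inv_mul_mem_pos, pos_ordering] at hkg hgl
  rcases hkg with hkg | ⟨i, hi⟩
  · rcases hgl with hgl | ⟨j, hj⟩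
    · refine absurd ?_ (hQ.zpow_notMem (-k + l))
      simpa [zpow_add] using hQ.mul_mem _ hkg _ hgl
    · have hg : g = b ^ l * (b ^ (j + 1))⁻¹ := by simp [hj]
      exact hg ▸ Subgroup.mul_mem _ ⟨l, rfl⟩ (inv_mem (pow_mem (Subgroup.mem_zpowers b) _))
  · have hg : g = b ^ k * b ^ (i + 1) := by simp [hi]
    exact hg ▸ Subgroup.mul_mem _ ⟨k, rfl⟩ (pow_mem (Subgroup.mem_zpowers b) _)

theorem eq_zpowers_or_exists_mem (hQ : IsRelCone Q b) {K : Subgroup G} (hb : b ∈ K) :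
    K = Subgroup.zpowers b ∨ ∃ q ∈ Q, q ∈ K := by
  by_cases hK : ∃ q ∈ Q, q ∈ K
  · exact .inr hK
  · refine .inl (le_antisymm (fun g hg => ?_) (Subgroup.zpowers_le.2 hb))
    rcases hQ.trichotomy g with h | h | h
    · exact absurd ⟨g, h, hg⟩ hK
    · exact absurd ⟨g⁻¹, h, K.inv_mem hg⟩ hK
    · exact h

theorem isConvex_iff (hQ : IsRelCone Q b)
    (htop : ∀ K : Subgroup G, hQ.ordering.IsConvex K → b ∈ K → ∀ q ∈ Q, q ∈ K → K = ⊤)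
    (K : Subgroup G) :
    hQ.ordering.IsConvex K ↔ K = ⊥ ∨ K = Subgroup.zpowers b ∨ K = ⊤ := by
  refine ⟨fun hK => or_iff_not_imp_left.2 fun hbot => ?_, ?_⟩
  · have hb : b ∈ K := hK.mem_of_isLeast_pos hbot hQ.base_mem_pos
      fun g hg => hQ.eq_base_or_inv_mul_mem_pos hg
    exact (hQ.eq_zpowers_or_exists_mem hb).imp_right fun ⟨q, hq, hqK⟩ => htop K hK hb q hq hqK
  · rintro (rfl | rfl | rfl)
    exacts [LeftOrdering.isConvex_bot, hQ.isConvex_zpowers, LeftOrdering.isConvex_top]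

end IsRelCone

/-! ### Words in which a generator occurs only positively -/

section HalfCone

variable {G : Type*} [Group G] {a b g h : G}

/-- The monoid of the elements represented by a word without the letter `a⁻¹`. -/
def halfMonoid (a b : G) : Submonoid G := Submonoid.closure {a, b, b⁻¹}

/-- The elements represented by a word that contains the letter `a` and not `a⁻¹`. -/
def halfCone (a b : G) : Set G := {g | ∃ u ∈ halfMonoid a b, ∃ v ∈ halfMonoid a b, g = u * a * v}

theorem left_mem_halfMonoid : a ∈ halfMonoid a b := Submonoid.subset_closure (by simp)

theorem right_mem_halfMonoid : b ∈ halfMonoid a b := Submonoid.subset_closure (by simp)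

theorem inv_right_mem_halfMonoid : b⁻¹ ∈ halfMonoid a b := Submonoid.subset_closure (by simp)

theorem halfMonoid_le {M : Submonoid G} (ha : a ∈ M) (hb : b ∈ M) (hb' : b⁻¹ ∈ M) :
    halfMonoid a b ≤ M := by
  simp [halfMonoid, Set.insert_subset_iff, ha, hb, hb']

theorem closure_pair_le_halfMonoid : Submonoid.closure {a, b} ≤ halfMonoid a b :=
  Submonoid.closure_mono (by grind)

theorem zpow_mem_halfMonoid (k : ℤ) : b ^ k ∈ halfMonoid a b := by
  cases k with
  | ofNat k => simpa using pow_mem right_mem_halfMonoid k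
  | negSucc k => simpa using pow_mem inv_right_mem_halfMonoid (k + 1)

theorem left_mem_halfCone : a ∈ halfCone a b := ⟨1, one_mem _, 1, one_mem _, by simp⟩

theorem halfCone_subset_halfMonoid : halfCone a b ⊆ halfMonoid a b := by
  rintro _ ⟨u, hu, v, hv, rfl⟩
  exact mul_mem (mul_mem hu left_mem_halfMonoid) hv

theorem halfCone_mul_mem (hg : g ∈ halfCone a b) (hh : h ∈ halfMonoid a b) :
    g * h ∈ halfCone a b := by
  obtain ⟨u, hu, v, hv, rfl⟩ := hg
  exact ⟨u, hu, v * h, mul_mem hv hh, by simp only [mul_assoc]⟩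

theorem mul_halfCone_mem (hg : g ∈ halfMonoid a b) (hh : h ∈ halfCone a b) :
    g * h ∈ halfCone a b := by
  obtain ⟨u, hu, v, hv, rfl⟩ := hh
  exact ⟨g * u, mul_mem hg hu, v, hv, by simp only [mul_assoc]⟩

theorem exists_zpow_mul_left_mul (hg : g ∈ halfMonoid a b) :
    (∃ k : ℤ, g = b ^ k) ∨ ∃ k : ℤ, ∃ p ∈ halfMonoid a b, g = b ^ k * (a * p) := by
  induction hg using Submonoid.closure_induction_left with
  | one => exact .inl ⟨0, by simp⟩
  | mul_left c hc g hg ih =>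
    have zpow_mul : ∀ l : ℤ, (∃ k : ℤ, b ^ l * g = b ^ k) ∨
        ∃ k : ℤ, ∃ p ∈ halfMonoid a b, b ^ l * g = b ^ k * (a * p) := fun l =>
      ih.imp (fun ⟨k, hk⟩ => ⟨l + k, by rw [hk, zpow_add]⟩)
        fun ⟨k, p, hp, hk⟩ => ⟨l + k, p, hp, by rw [hk, zpow_add, mul_assoc]⟩
    rcases hc with rfl | rfl | rfl
    · exact .inr ⟨0, g, hg, by simp⟩
    · simpa using zpow_mul 1
    · simpa using zpow_mul (-1)

theorem mem_halfCone_or_mem_zpowers (hg : g ∈ halfMonoid a b) :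
    g ∈ halfCone a b ∨ g ∈ Subgroup.zpowers b := by
  rcases exists_zpow_mul_left_mul hg with ⟨k, rfl⟩ | ⟨k, p, hp, rfl⟩
  · exact .inr ⟨k, rfl⟩
  · exact .inl (mul_halfCone_mem (zpow_mem_halfMonoid k) (halfCone_mul_mem left_mem_halfCone hp))

theorem halfMonoid_mul_inv : halfMonoid (a * b) b⁻¹ = halfMonoid a b := by
  refine le_antisymm (halfMonoid_le (mul_mem left_mem_halfMonoid right_mem_halfMonoid)
    inv_right_mem_halfMonoid (by simpa using right_mem_halfMonoid))
    (halfMonoid_le ?_ (by simpa using inv_right_mem_halfMonoid (a := a * b) (b := b⁻¹))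
      right_mem_halfMonoid)
  simpa only [mul_inv_cancel_right] using
    mul_mem (left_mem_halfMonoid (a := a * b) (b := b⁻¹)) right_mem_halfMonoid

theorem halfCone_mul_inv : halfCone (a * b) b⁻¹ = halfCone a b := by
  ext g
  simp only [halfCone, halfMonoid_mul_inv]
  constructor
  · rintro ⟨u, hu, v, hv, rfl⟩
    exact ⟨u, hu, b * v, mul_mem right_mem_halfMonoid hv, by simp only [mul_assoc]⟩
  · rintro ⟨u, hu, v, hv, rfl⟩
    exact ⟨u, hu, b⁻¹ * v, mul_mem inv_right_mem_halfMonoid hv, by simp [mul_assoc]⟩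

theorem closure_mul_inv : Subgroup.closure {a * b, b⁻¹} = Subgroup.closure {a, b} := by
  apply le_antisymm <;> rw [Subgroup.closure_le, Set.pair_subset_iff]
  · have ha : a ∈ Subgroup.closure {a, b} := Subgroup.subset_closure (by simp)
    have hb : b ∈ Subgroup.closure {a, b} := Subgroup.subset_closure (by simp)
    exact ⟨mul_mem ha hb, inv_mem hb⟩
  · have hab : a * b ∈ Subgroup.closure {a * b, b⁻¹} := Subgroup.subset_closure (by simp)
    have hb : b⁻¹ ∈ Subgroup.closure {a * b, b⁻¹} := Subgroup.subset_closure (by simp)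
    exact ⟨by simpa using mul_mem hab hb, by simpa using inv_mem hb⟩

theorem isRelCone_halfCone (h1 : (1 : G) ∉ halfCone a b) (hb : ¬ IsOfFinOrder b)
    (htot : ∀ g : G, g ∈ halfMonoid a b ∨ g⁻¹ ∈ halfMonoid a b) :
    IsRelCone (halfCone a b) b where
  mul_mem _ hg _ hh := halfCone_mul_mem hg (halfCone_subset_halfMonoid hh)
  zpow_mul_mem k _ hg := mul_halfCone_mem (zpow_mem_halfMonoid k) hg
  mul_zpow_mem k _ hg := halfCone_mul_mem hg (zpow_mem_halfMonoid k)
  one_notMem := h1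
  trichotomy g := by
    rcases htot g with h | h <;> rcases mem_halfCone_or_mem_zpowers h with h | h
    · exact .inl h
    · exact .inr (.inr h)
    · exact .inr (.inl h)
    · exact .inr (.inr (by simpa using h))
  not_isOfFinOrder := hb

theorem IsRelCone.mul_inv (hQ : IsRelCone (halfCone a b) b) :
    IsRelCone (halfCone (a * b) b⁻¹) b⁻¹ :=
  halfCone_mul_inv (a := a) (b := b) ▸ hQ.inv

theorem left_mem_of_isConvex (hQ : IsRelCone (halfCone a b) b) {K : Subgroup G}
    (hK : hQ.ordering.IsConvex K) (hb : b ∈ K) (hg : g ∈ halfCone a b) (hgK : g ∈ K) : a ∈ K := by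
  obtain ⟨k, rfl⟩ | ⟨k, p, hp, rfl⟩ := exists_zpow_mul_left_mul (halfCone_subset_halfMonoid hg)
  · exact absurd hg (hQ.zpow_notMem k)
  have hap : a * p ∈ K := by simpa using K.mul_mem (K.zpow_mem hb (-k)) hgK
  rcases mem_halfCone_or_mem_zpowers hp with hp | ⟨l, rfl⟩
  · exact hK.mem hap (hQ.mem_pos_of_mem left_mem_halfCone) (by simpa using hQ.mem_pos_of_mem hp)
  · simpa using K.mul_mem hap (K.zpow_mem hb (-l))

theorem isConvex_ordering_halfCone_iff (hQ : IsRelCone (halfCone a b) b)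
    (htop : Subgroup.closure {a, b} = ⊤) (K : Subgroup G) :
    hQ.ordering.IsConvex K ↔ K = ⊥ ∨ K = Subgroup.zpowers b ∨ K = ⊤ := by
  refine hQ.isConvex_iff (fun K hK hb q hq hqK => ?_) K
  have ha : a ∈ K := left_mem_of_isConvex hQ hK hb hq hqK
  rw [eq_top_iff, ← htop, Subgroup.closure_le, Set.pair_subset_iff]
  exact ⟨ha, hb⟩

theorem isConradianSoul_ordering_halfCone (hQ : IsRelCone (halfCone a b) b)
    (htop : Subgroup.closure {a, b} = ⊤)
    (hnot : ∃ f ∈ halfCone a b, ∃ g ∈ halfCone a b, (g⁻¹ * (f * g ^ 2))⁻¹ ∈ halfCone a b) :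
    hQ.ordering.IsConradianSoul (Subgroup.zpowers b) := by
  obtain ⟨f, hf, g, hg, hfg⟩ := hnot
  refine LeftOrdering.isConradianSoul_of_isConvex_iff (isConvex_ordering_halfCone_iff hQ htop)
    (LeftOrdering.isConradian _) fun hC => ?_
  refine hQ.ordering.inv_notMem_pos ?_ (hQ.mem_pos_of_mem hfg)
  exact LeftOrdering.lt_iff_inv_mul_mem_pos _ |>.1
    (hC f g (hQ.mem_pos_of_mem hf) (hQ.mem_pos_of_mem hg) 2 le_rfl)

theorem one_notMem_halfCone_of_orderIso {Ω : Type*} [Preorder Ω] (φ : G →* (Ω ≃o Ω)) (p : Ω)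
    (hb : φ b p = p) (ha : p < φ a p) : (1 : G) ∉ halfCone a b := by
  have hb' : φ b⁻¹ p = p := by
    rw [map_inv]
    exact (φ b).symm_apply_eq.2 hb.symm
  have hle : ∀ g ∈ halfMonoid a b, p ≤ φ g p := fun g hg => by
    induction hg using Submonoid.closure_induction_left with
    | one => simp
    | mul_left c hc g _ ih =>
      refine le_trans ?_ (((φ c).monotone ih).trans_eq (by rw [map_mul, RelIso.mul_apply]))
      rcases hc with rfl | rfl | rfl
      exacts [ha.le, hb.ge, hb'.ge]
  rintro ⟨u, hu, v, hv, huv⟩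
  have hlt : p < φ u (φ a (φ v p)) :=
    (hle u hu).trans_lt ((φ u).strictMono (ha.trans_le ((φ a).monotone (hle v hv))))
  rw [← RelIso.mul_apply, ← RelIso.mul_apply, ← map_mul, ← map_mul, ← huv] at hlt
  simp at hlt

end HalfCone

section Words

variable {G : Type*} [Group G] {s t : G}

theorem wordValue_append {k : ℕ} (s : Fin k → G) (v w : List (Fin k × Bool)) :
    wordValue s (v ++ w) = wordValue s v * wordValue s w := by
  simp [wordValue]

theorem wordValue_cons {k : ℕ} (s : Fin k → G) (p : Fin k × Bool) (w : List (Fin k × Bool)) :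
    wordValue s (p :: w) = (if p.2 then s p.1 else (s p.1)⁻¹) * wordValue s w := by
  simp [wordValue]

theorem wordValue_mem_halfMonoid {w : List (Fin 2 × Bool)} (hw : (0, false) ∉ w) :
    wordValue ![s, t] w ∈ halfMonoid s t := by
  refine Submonoid.list_prod_mem _ fun c hc => ?_
  obtain ⟨⟨i, e⟩, hmem, rfl⟩ := List.mem_map.1 hc
  fin_cases i <;> cases e
  · exact absurd hmem hw
  exacts [left_mem_halfMonoid, inv_right_mem_halfMonoid, right_mem_halfMonoid]

theorem exists_word_of_mem_halfMonoid {g : G} (hg : g ∈ halfMonoid s t) :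
    ∃ w : List (Fin 2 × Bool), (0, false) ∉ w ∧ wordValue ![s, t] w = g := by
  induction hg using Submonoid.closure_induction_left with
  | one => exact ⟨[], by simp, by simp [wordValue]⟩
  | mul_left c hc g _ ih =>
    obtain ⟨w, hw, rfl⟩ := ih
    rcases hc with rfl | rfl | rfl
    · exact ⟨(0, true) :: w, by simpa using hw, by simp [wordValue_cons]⟩
    · exact ⟨(1, true) :: w, by simpa using hw, by simp [wordValue_cons]⟩
    · exact ⟨(1, false) :: w, by simpa using hw, by simp [wordValue_cons]⟩

theorem wordValue_mem_halfCone {w : List (Fin 2 × Bool)} (hw : IsPositiveWord 0 w) :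
    wordValue ![s, t] w ∈ halfCone s t := by
  obtain ⟨htrue, hfalse, -⟩ := hw
  obtain ⟨u, v, rfl⟩ := List.append_of_mem htrue
  simp only [List.mem_append, List.mem_cons, not_or] at hfalse
  exact ⟨_, wordValue_mem_halfMonoid hfalse.1, _, wordValue_mem_halfMonoid hfalse.2.2,
    by simp [wordValue_append, wordValue_cons, mul_assoc]⟩

theorem wordValue_eq_pow {w : List (Fin 2 × Bool)} (hw : IsPositiveWord 1 w) :
    wordValue ![s, t] w = t ^ w.length := by
  have hmem : ∀ p ∈ w, p = ((1 : Fin 2), true) := by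
    rintro ⟨i, e⟩ hp
    fin_cases i
    · exact absurd hp (hw.2.2 0 (by decide) e)
    · cases e
      exacts [absurd hp hw.2.1, rfl]
  rw [List.eq_replicate_of_mem hmem]
  simp [wordValue]

theorem sigmaPositive_pair : sigmaPositive ![s, t] = relCone (halfCone s t) t := by
  ext g
  constructor
  · rintro ⟨i, w, hw, rfl⟩
    fin_cases i
    · exact .inl (wordValue_mem_halfCone hw)
    · have hlen : w.length - 1 + 1 = w.length :=
        Nat.sub_add_cancel (List.length_pos_of_mem hw.1)
      exact .inr ⟨w.length - 1, by simp only [hlen]; exact (wordValue_eq_pow hw).symm⟩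
  · rintro (⟨u, hu, v, hv, rfl⟩ | ⟨k, rfl⟩)
    · obtain ⟨u, hfalse_u, rfl⟩ := exists_word_of_mem_halfMonoid hu
      obtain ⟨v, hfalse_v, rfl⟩ := exists_word_of_mem_halfMonoid hv
      exact ⟨0, u ++ (0, true) :: v, ⟨by simp, by simp [hfalse_u, hfalse_v], by simp⟩,
        by simp [wordValue_append, wordValue_cons, mul_assoc]⟩
    · exact ⟨1, List.replicate (k + 1) (1, true), ⟨by simp, by simp, by simp⟩, by simp [wordValue]⟩

end Words

/-! ### Conjugates of the ordering -/

section Conjugation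

variable {G : Type*} [Group G] {a b : G}

theorem eventually_mem_pos_conj (hQ : IsRelCone (halfCone a b) b)
    (hl : a⁻¹ * b * a ∈ halfCone a b) {u : G} (hu : u ∈ hQ.ordering.pos) :
    ∀ᶠ i : ℕ in atTop, u ∈ (hQ.ordering.conj (b⁻¹ ^ i * a)).pos := by
  have conj_pow_b : ∀ j : ℕ, a⁻¹ * b ^ j * a = (a⁻¹ * b * a) ^ j := fun j => by
    simpa using (conj_pow (i := j) (a := a⁻¹) (b := b)).symm
  rw [hQ.pos_ordering] at hu
  rcases hu with hu | ⟨k, rfl⟩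
  · rcases exists_zpow_mul_left_mul (halfCone_subset_halfMonoid hu) with ⟨k, rfl⟩ | ⟨k, p, hp, rfl⟩
    · exact absurd hu (hQ.zpow_notMem k)
    filter_upwards [eventually_ge_atTop (-k).toNat] with i hi
    obtain ⟨j, hj⟩ : ∃ j : ℕ, i + k = j := ⟨(i + k).toNat, by omega⟩
    have hconj : (b⁻¹ ^ i * a)⁻¹ * (b ^ k * (a * p)) * (b⁻¹ ^ i * a) =
        (a⁻¹ * b * a) ^ j * (p * b⁻¹ ^ i * a) := by
      rw [← conj_pow_b, ← zpow_natCast b j, ← hj, zpow_add, zpow_natCast]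
      group
    rw [LeftOrdering.mem_pos_conj, hconj]
    refine hQ.mem_pos_of_mem (mul_halfCone_mem (pow_mem (halfCone_subset_halfMonoid hl) j)
      (mul_halfCone_mem (mul_mem hp (pow_mem inv_right_mem_halfMonoid i)) left_mem_halfCone))
  · refine Eventually.of_forall fun i => ?_
    have hconj : (b⁻¹ ^ i * a)⁻¹ * b ^ (k + 1) * (b⁻¹ ^ i * a) =
        (a⁻¹ * b * a) ^ k * (a⁻¹ * b * a) := by
      rw [← pow_succ, ← conj_pow_b]
      group
    rw [LeftOrdering.mem_pos_conj, hconj]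
    exact hQ.mem_pos_of_mem (mul_halfCone_mem (pow_mem (halfCone_subset_halfMonoid hl) k) hl)

theorem conj_ordering_ne (hQ : IsRelCone (halfCone a b) b) (hl : a⁻¹ * b * a ∈ halfCone a b)
    (hr : a * b * a⁻¹ ∈ halfCone a b) (i : ℕ) :
    hQ.ordering.conj (b⁻¹ ^ i * a) ≠ hQ.ordering := by
  intro heq
  have hu : b ^ (-(i : ℤ) - 1) * (a * b * a⁻¹) * b ^ (i : ℤ) ∈ hQ.ordering.pos :=
    hQ.mem_pos_of_mem (hQ.mul_zpow_mem _ _ (hQ.zpow_mul_mem _ _ hr))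
  rw [← heq, LeftOrdering.mem_pos_conj] at hu
  refine hQ.ordering.inv_notMem_pos hu ?_
  convert hQ.mem_pos_of_mem (hQ.zpow_mul_mem (-1) _ hl) using 1
  group

theorem accPt_conj (hQ : IsRelCone (halfCone a b) b) (hl : a⁻¹ * b * a ∈ halfCone a b)
    (hr : a * b * a⁻¹ ∈ halfCone a b) :
    AccPt hQ.ordering (𝓟 (Set.range fun g : G => hQ.ordering.conj g)) := by
  have htendsto : Tendsto (fun i : ℕ => hQ.ordering.conj (b⁻¹ ^ i * a)) atTop (𝓝 hQ.ordering) :=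
    hQ.ordering.tendsto_nhds_of_eventually_mem_pos fun u hu => eventually_mem_pos_conj hQ hl hu
  exact accPt_iff_frequently.2 <| htendsto.frequently <|
    .of_forall fun i => ⟨conj_ordering_ne hQ hl hr i, _, rfl⟩

end Conjugation

/-! ### The relation `a = b * a * e * a * b` -/

section Relation

variable {G : Type*} [Group G] {a b e : G}

theorem inv_mul_inv_mul_eq (hrel : a = b * a * e * a * b) : a⁻¹ * b⁻¹ * a = e * a * b := by
  nth_rw 2 [hrel]
  group

theorem mul_inv_mul_inv_eq (hrel : a = b * a * e * a * b) : a * b⁻¹ * a⁻¹ = b * a * e := by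
  nth_rw 1 [hrel]
  group

theorem inv_mul_inv_mul_mem_halfCone (he : e ∈ halfMonoid a b) (hrel : a = b * a * e * a * b) :
    a⁻¹ * b⁻¹ * a ∈ halfCone a b :=
  ⟨e, he, b, right_mem_halfMonoid, inv_mul_inv_mul_eq hrel⟩

theorem mul_inv_mul_inv_mem_halfCone (he : e ∈ halfMonoid a b) (hrel : a = b * a * e * a * b) :
    a * b⁻¹ * a⁻¹ ∈ halfCone a b :=
  ⟨b, right_mem_halfMonoid, e, he, mul_inv_mul_inv_eq hrel⟩

theorem not_isOfFinOrder_right (he : e ∈ halfMonoid a b) (hrel : a = b * a * e * a * b)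
    (h1 : (1 : G) ∉ halfCone a b) : ¬ IsOfFinOrder b := by
  intro hb
  obtain ⟨k, hk, hbk⟩ := isOfFinOrder_iff_pow_eq_one.1 hb
  have hmem := inv_mul_inv_mul_mem_halfCone he hrel
  have hone : (a⁻¹ * b⁻¹ * a) ^ k = 1 := by
    simpa [hbk] using conj_pow (i := k) (a := a⁻¹) (b := b⁻¹)
  rw [← Nat.sub_add_cancel hk, pow_succ] at hone
  exact h1 (hone ▸ mul_halfCone_mem (pow_mem (halfCone_subset_halfMonoid hmem) _) hmem)

theorem exists_inv_mul_mul_sq_inv_mem_halfCone (he : e ∈ halfMonoid a b)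
    (hrel : a = b * a * e * a * b) :
    ∃ f ∈ halfCone a b, ∃ g ∈ halfCone a b, (g⁻¹ * (f * g ^ 2))⁻¹ ∈ halfCone a b := by
  have hg := mul_inv_mul_inv_mem_halfCone he hrel
  refine ⟨_, mul_halfCone_mem right_mem_halfMonoid hg, _, hg, ?_⟩
  have hneg : ((a * b⁻¹ * a⁻¹)⁻¹ * (b * (a * b⁻¹ * a⁻¹) * (a * b⁻¹ * a⁻¹) ^ 2))⁻¹ =
      1 * a * (b ^ 3 * e) :=
    calc _ = a * b ^ 3 * (a⁻¹ * b⁻¹ * a) * b⁻¹ * a⁻¹ := by rw [pow_two]; group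
      _ = 1 * a * (b ^ 3 * e) := by rw [inv_mul_inv_mul_eq hrel]; group
  exact ⟨1, one_mem _, _, mul_mem (pow_mem right_mem_halfMonoid 3) he, hneg⟩

theorem accPt_conj_of_relation (hQ : IsRelCone (halfCone a b) b) (he : e ∈ halfMonoid a b)
    (hrel : a = b * a * e * a * b) :
    AccPt hQ.mul_inv.ordering (𝓟 (Set.range fun g : G => hQ.mul_inv.ordering.conj g)) := by
  refine accPt_conj hQ.mul_inv ?_ ?_ <;> rw [halfCone_mul_inv]
  · have hconj : (a * b)⁻¹ * b⁻¹ * (a * b) = b⁻¹ * (a⁻¹ * b⁻¹ * a) * b := by group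
    exact hconj ▸ halfCone_mul_mem
      (mul_halfCone_mem inv_right_mem_halfMonoid (inv_mul_inv_mul_mem_halfCone he hrel))
      right_mem_halfMonoid
  · have hconj : a * b * b⁻¹ * (a * b)⁻¹ = a * b⁻¹ * a⁻¹ := by group
    exact hconj ▸ mul_inv_mul_inv_mem_halfCone he hrel

theorem exists_relation_of_pow_eq {p q : ℕ} (hp : 1 ≤ p) (hq : 1 ≤ q) (hpq : (p, q) ≠ (1, 1))
    (h : a ^ (p + 1) = (b * a ^ p) ^ (q + 1)) : ∃ e ∈ halfMonoid a b, a = b * a * e * a * b := by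
  have ha : a = (b * a ^ p) ^ q * b := by
    rwa [pow_succ', pow_succ, ← mul_assoc, mul_left_inj] at h
  have hpow : ∀ i, a ^ i ∈ halfMonoid a b := pow_mem left_mem_halfMonoid
  rcases hq.eq_or_lt with rfl | hq2
  · have hp1 : p ≠ 1 := fun h => hpq (by rw [h])
    obtain ⟨p, rfl⟩ : ∃ p', p = p' + 2 := ⟨p - 2, by omega⟩
    refine ⟨a ^ p, hpow p, ha.trans ?_⟩
    simp only [pow_one, pow_succ a (p + 1), pow_succ' a p, mul_assoc]
  · obtain ⟨p, rfl⟩ := Nat.exists_eq_add_of_le' hp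
    obtain ⟨q, rfl⟩ := Nat.exists_eq_add_of_le' hq2
    refine ⟨a ^ p * (b * a ^ (p + 1)) ^ q * b * a ^ p, mul_mem (mul_mem (mul_mem (hpow p)
      (pow_mem (mul_mem right_mem_halfMonoid (hpow _)) q)) right_mem_halfMonoid) (hpow p),
      ha.trans ?_⟩
    rw [pow_succ, pow_succ' _ q]
    nth_rw 1 [pow_succ' a p]
    nth_rw 2 [pow_succ a p]
    simp only [mul_assoc]

end Relation

/-! ### Amalgams of two infinite cyclic groups -/

section Amalgam

variable {G : Type*} [Group G] {x y z b g h : G} {m n : ℕ}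

/-- The products `y ^ j₁ * x ^ i₁ * y ^ j₂ * ⋯ * z ^ k` with exponents `0 < i < m` and `0 < j < n`,
except that the last `j` may be `0`. If `x ^ m = z = y ^ n`, these are the elements of the amalgam
of `⟨x⟩` and `⟨y⟩` over `⟨z⟩` whose normal form does not begin with a power of `x`. -/
inductive IsAmalgamReduced (x y z : G) (m n : ℕ) : G → Prop
  | pow_mul_zpow {j : ℕ} (k : ℤ) (hj : j < n) : IsAmalgamReduced x y z m n (y ^ j * z ^ k)
  | pow_mul_pow_mul {i j : ℕ} {h : G} (hi : 0 < i) (him : i < m) (hj : 0 < j) (hjn : j < n)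
      (hh : IsAmalgamReduced x y z m n h) : IsAmalgamReduced x y z m n (y ^ j * (x ^ i * h))

/-- The elements that have a normal form in the amalgam of `⟨x⟩` and `⟨y⟩` over `⟨z⟩`. -/
def HasNormalForm (x y z : G) (m n : ℕ) (g : G) : Prop :=
  ∃ i < m, ∃ h, IsAmalgamReduced x y z m n h ∧ g = x ^ i * h

theorem commute_of_pow_eq_of_closure_eq_top (hx : x ^ m = z) (hy : y ^ n = z)
    (htop : Subgroup.closure {x, y} = ⊤) (g : G) : Commute z g := by
  have hle : Subgroup.closure {x, y} ≤ Subgroup.centralizer {z} := by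
    rw [Subgroup.closure_le, Set.pair_subset_iff]
    constructor <;> rw [SetLike.mem_coe, Subgroup.mem_centralizer_singleton_iff]
    exacts [hx ▸ Commute.self_pow x m, hy ▸ Commute.self_pow y n]
  exact (Subgroup.mem_centralizer_singleton_iff.1 (hle (htop ▸ Subgroup.mem_top g))).symm

theorem IsAmalgamReduced.mul_zpow (hh : IsAmalgamReduced x y z m n h) (l : ℤ) :
    IsAmalgamReduced x y z m n (h * z ^ l) := by
  induction hh with
  | pow_mul_zpow k hj =>
    rw [mul_assoc, ← zpow_add]
    exact .pow_mul_zpow _ hj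
  | pow_mul_pow_mul hi him hj hjn _ ih =>
    rw [mul_assoc, mul_assoc]
    exact .pow_mul_pow_mul hi him hj hjn ih

theorem HasNormalForm.mul_zpow (hg : HasNormalForm x y z m n g) (l : ℤ) :
    HasNormalForm x y z m n (g * z ^ l) := by
  obtain ⟨i, hi, h, hh, rfl⟩ := hg
  exact ⟨i, hi, _, hh.mul_zpow l, mul_assoc _ _ _⟩

theorem IsAmalgamReduced.hasNormalForm (hm : 0 < m) (hh : IsAmalgamReduced x y z m n h) :
    HasNormalForm x y z m n h :=
  ⟨0, hm, h, hh, by simp⟩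

theorem HasNormalForm.x_mul (hx : x ^ m = z) (hz : ∀ g, Commute z g)
    (hg : HasNormalForm x y z m n g) : HasNormalForm x y z m n (x * g) := by
  obtain ⟨i, hi, h, hh, rfl⟩ := hg
  obtain hlt | rfl : i + 1 < m ∨ i + 1 = m := by omega
  · exact ⟨i + 1, hlt, h, hh, by rw [pow_succ', mul_assoc]⟩
  · have hmul : x * (x ^ i * h) = h * z ^ (1 : ℤ) := by
      rw [← mul_assoc, ← pow_succ', hx, zpow_one, (hz h).eq]
    exact hmul ▸ (hh.mul_zpow 1).hasNormalForm i.succ_pos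

theorem IsAmalgamReduced.y_mul (hm : 0 < m) (hy : y ^ n = z) (hz : ∀ g, Commute z g)
    (hh : IsAmalgamReduced x y z m n h) : HasNormalForm x y z m n (y * h) := by
  have mul_pow_mul : ∀ (j : ℕ) (g : G), y * (y ^ j * g) = y ^ (j + 1) * g := fun j g => by
    rw [pow_succ', mul_assoc]
  cases hh with
  | @pow_mul_zpow j k hj =>
    rw [mul_pow_mul]
    obtain hlt | rfl : j + 1 < n ∨ j + 1 = n := by omega
    · exact (IsAmalgamReduced.pow_mul_zpow k hlt).hasNormalForm hm
    · have hzk : y ^ (j + 1) * z ^ k = y ^ 0 * z ^ (k + 1) := by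
        rw [hy, pow_zero, one_mul, zpow_add_one, (hz _).eq]
      exact hzk ▸ (IsAmalgamReduced.pow_mul_zpow (k + 1) j.succ_pos).hasNormalForm hm
  | @pow_mul_pow_mul i j h hi him hj hjn hh =>
    rw [mul_pow_mul]
    obtain hlt | rfl : j + 1 < n ∨ j + 1 = n := by omega
    · exact (hh.pow_mul_pow_mul hi him j.succ_pos hlt).hasNormalForm hm
    · refine ⟨i, him, _, hh.mul_zpow 1, ?_⟩
      rw [hy, (hz _).eq, zpow_one, mul_assoc]

theorem HasNormalForm.y_mul (hn : 2 ≤ n) (hy : y ^ n = z) (hz : ∀ g, Commute z g)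
    (hg : HasNormalForm x y z m n g) : HasNormalForm x y z m n (y * g) := by
  obtain ⟨_ | i, hi, h, hh, rfl⟩ := hg
  · simpa using hh.y_mul hi hy hz
  · simpa using (hh.pow_mul_pow_mul i.succ_pos hi one_pos hn).hasNormalForm (by omega)

theorem HasNormalForm.inv_mul {c : G} {k : ℕ} (hk : 0 < k) (hc : c ^ k = z)
    (hz : ∀ g, Commute z g)
    (hmul : ∀ g, HasNormalForm x y z m n g → HasNormalForm x y z m n (c * g))
    (hg : HasNormalForm x y z m n g) : HasNormalForm x y z m n (c⁻¹ * g) := by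
  have hpow : ∀ i, HasNormalForm x y z m n (c ^ i * (g * z ^ (-1 : ℤ))) := fun i => by
    induction i with
    | zero => simpa using hg.mul_zpow (-1)
    | succ i ih => simpa only [pow_succ', mul_assoc] using hmul _ ih
  convert hpow (k - 1) using 1
  rw [inv_mul_eq_iff_eq_mul, ← mul_assoc, mul_pow_sub_one hk.ne', hc, (hz _).eq, zpow_neg_one,
    inv_mul_cancel_right]

theorem hasNormalForm_of_closure_eq_top (hm : 0 < m) (hn : 2 ≤ n) (hx : x ^ m = z)
    (hy : y ^ n = z) (htop : Subgroup.closure {x, y} = ⊤) (g : G) :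
    HasNormalForm x y z m n g := by
  have hz := commute_of_pow_eq_of_closure_eq_top hx hy htop
  have x_mul := fun g (hg : HasNormalForm x y z m n g) => hg.x_mul hx hz
  have y_mul := fun g (hg : HasNormalForm x y z m n g) => hg.y_mul hn hy hz
  induction (htop ▸ Subgroup.mem_top g : g ∈ Subgroup.closure {x, y})
    using Subgroup.closure_induction_left with
  | one => simpa using (IsAmalgamReduced.pow_mul_zpow 0 (by omega : 0 < n)).hasNormalForm hm
  | mul_left c hc g _ ih =>
    rcases hc with rfl | rfl
    exacts [x_mul g ih, y_mul g ih]
  | inv_mul_cancel c hc g _ ih =>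
    rcases hc with rfl | rfl
    exacts [ih.inv_mul hm hx hz x_mul, ih.inv_mul (by omega) hy hz y_mul]

theorem pow_sub_mul_mul_pow_mul (hy : y ^ n = z) {j : ℕ} (hj : j < n) (g : G) :
    y ^ (n - 1 - j) * (y * (y ^ j * g)) = z * g := by
  rw [← mul_assoc y, ← pow_succ', ← mul_assoc, ← pow_add, ← hy]
  congr 2
  omega

/-- For `0 ≤ t` the first equation shows that `h` is a product of `x`s and `b`s. For `t < 0` the
second one shows the same for `(x ^ i * h)⁻¹ = z ^ (-t - 1) * q * (y * x ^ (-i))`, as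
`y * x ^ (-i) = b * x ^ (m - 1 - i)`. -/
theorem IsAmalgamReduced.exists_mem_closure (hx : x ^ m = z) (hy : y ^ n = z)
    (hz : ∀ g, Commute z g) (hb : b * x ^ (m - 1) = y) (hh : IsAmalgamReduced x y z m n h) :
    ∃ t : ℤ, ∃ p ∈ Submonoid.closure {x, b}, ∃ q ∈ Submonoid.closure {x, b},
      h = p * z ^ t ∧ q * (y * h) = z ^ (t + 1) := by
  have hxP : ∀ k, x ^ k ∈ Submonoid.closure {x, b} :=
    pow_mem (Submonoid.subset_closure (by simp))
  have hbP : b ∈ Submonoid.closure {x, b} := Submonoid.subset_closure (by simp)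
  have hyP : ∀ k, y ^ k ∈ Submonoid.closure {x, b} := pow_mem (hb ▸ mul_mem hbP (hxP _))
  induction hh with
  | @pow_mul_zpow j k hj =>
    refine ⟨k, y ^ j, hyP j, y ^ (n - 1 - j), hyP _, rfl, ?_⟩
    rw [pow_sub_mul_mul_pow_mul hy hj, zpow_add_one, (hz _).eq]
  | @pow_mul_pow_mul i j h hi him hj hjn _ ih =>
    obtain ⟨t, p, hp, q, hq, hpt, hqt⟩ := ih
    have hyx : y * x = b * z := by rw [← hb, mul_assoc, pow_sub_one_mul (by omega), hx]
    refine ⟨t + 1, y ^ (j - 1) * (b * (x ^ (i - 1) * p)),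
      mul_mem (hyP _) (mul_mem hbP (mul_mem (hxP _) hp)),
      q * (b * (x ^ (m - 1 - i) * y ^ (n - 1 - j))),
      mul_mem hq (mul_mem hbP (mul_mem (hxP _) (hyP _))), ?_, ?_⟩
    · calc y ^ j * (x ^ i * h) = y ^ (j - 1) * ((y * x) * (x ^ (i - 1) * (p * z ^ t))) := by
            rw [← pow_sub_one_mul hj.ne' y, ← mul_pow_sub_one hi.ne' x, hpt]
            simp only [mul_assoc]
        _ = y ^ (j - 1) * (b * (x ^ (i - 1) * p)) * z ^ (t + 1) := by
            rw [hyx, mul_assoc b, (hz _).eq, zpow_add_one]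
            simp only [mul_assoc]
    · calc q * (b * (x ^ (m - 1 - i) * y ^ (n - 1 - j))) * (y * (y ^ j * (x ^ i * h)))
          = q * (b * (x ^ (m - 1 - i) * (z * (x ^ i * h)))) := by
            rw [← pow_sub_mul_mul_pow_mul hy hjn]
            simp only [mul_assoc]
        _ = q * (b * (x ^ (m - 1 - i) * x ^ i) * h) * z := by
            rw [(hz _).eq]
            simp only [mul_assoc]
        _ = z ^ (t + 1 + 1) := by
            rw [← pow_add, Nat.sub_add_cancel (by omega), hb, hqt, zpow_add_one z (t + 1)]

theorem mem_closure_or_inv_mem_closure (hm : 0 < m) (hn : 2 ≤ n) (hxy : x ^ m = y ^ n)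
    (hb : b * x ^ (m - 1) = y) (htop : Subgroup.closure {x, y} = ⊤) (g : G) :
    g ∈ Submonoid.closure {x, b} ∨ g⁻¹ ∈ Submonoid.closure {x, b} := by
  have hz := commute_of_pow_eq_of_closure_eq_top rfl hxy.symm htop
  obtain ⟨i, hi, h, hh, rfl⟩ := hasNormalForm_of_closure_eq_top hm hn rfl hxy.symm htop g
  obtain ⟨t, p, hp, q, hq, hpt, hqt⟩ := hh.exists_mem_closure rfl hxy.symm hz hb
  have hxP : ∀ k, x ^ k ∈ Submonoid.closure {x, b} :=
    pow_mem (Submonoid.subset_closure (by simp))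
  have hbP : b ∈ Submonoid.closure {x, b} := Submonoid.subset_closure (by simp)
  rcases t with t | t
  · left
    rw [hpt, Int.ofNat_eq_natCast, zpow_natCast]
    exact mul_mem (hxP i) (mul_mem hp (pow_mem (hxP m) t))
  · right
    have hinv : (x ^ i * h)⁻¹ = (x ^ m) ^ t * (q * (b * x ^ (m - 1 - i))) := by
      refine inv_eq_of_mul_eq_one_left ?_
      calc (x ^ m) ^ t * (q * (b * x ^ (m - 1 - i))) * (x ^ i * h)
          = (x ^ m) ^ t * (q * (b * (x ^ (m - 1 - i) * x ^ i) * h)) := by simp only [mul_assoc]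
        _ = (x ^ m) ^ t * (x ^ m) ^ (Int.negSucc t + 1) := by
            rw [← pow_add, Nat.sub_add_cancel (by omega), hb, hqt]
        _ = 1 := by rw [← zpow_natCast, ← zpow_add, Int.negSucc_eq]; simp
    exact hinv ▸ mul_mem (pow_mem (hxP m) t) (mul_mem hq (mul_mem hbP (hxP _)))

end Amalgam

/-! ### Roots of the unit translation of the line -/

section RealLine

variable {r t : ℝ}

/-- The map of the line that commutes with integer translations and is `t ↦ t ^ r` on `[0, 1)`. -/
noncomputable def floorRpow (r t : ℝ) : ℝ := ⌊t⌋ + Int.fract t ^ r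

theorem floor_floorRpow (hr : 0 < r) : ⌊floorRpow r t⌋ = ⌊t⌋ := by
  rw [floorRpow, Int.floor_intCast_add, add_eq_left, Int.floor_eq_zero_iff]
  exact ⟨Real.rpow_nonneg (Int.fract_nonneg t) r,
    Real.rpow_lt_one (Int.fract_nonneg t) (Int.fract_lt_one t) hr⟩

theorem fract_floorRpow (hr : 0 < r) : Int.fract (floorRpow r t) = Int.fract t ^ r := by
  rw [Int.fract, floor_floorRpow hr, floorRpow, add_sub_cancel_left]

theorem strictMono_floorRpow (hr : 0 < r) : StrictMono (floorRpow r) := by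
  intro s t hst
  rcases (Int.floor_mono hst.le).lt_or_eq with hfloor | hfloor
  · refine lt_of_not_ge fun hle => ?_
    have hfloor' := Int.floor_mono hle
    rw [floor_floorRpow hr, floor_floorRpow hr] at hfloor'
    exact hfloor.not_ge hfloor'
  · have hfract : Int.fract s < Int.fract t := by
      rw [Int.fract, Int.fract, hfloor]
      exact sub_lt_sub_right hst _
    rw [floorRpow, floorRpow, hfloor]
    gcongr

theorem floorRpow_floorRpow_inv (hr : 0 < r) (t : ℝ) : floorRpow r (floorRpow r⁻¹ t) = t := by
  rw [floorRpow, floor_floorRpow (inv_pos.2 hr), fract_floorRpow (inv_pos.2 hr),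
    Real.rpow_inv_rpow (Int.fract_nonneg t) hr.ne', Int.floor_add_fract]

theorem floorRpow_add_one : floorRpow r (t + 1) = floorRpow r t + 1 := by
  simp only [floorRpow, Int.floor_add_one, Int.fract_add_one, Int.cast_add, Int.cast_one]
  ring

theorem exists_orderIso_add_one_apply_eq {u v : ℝ} (hu : u ∈ Set.Ioo 0 1) (hv : v ∈ Set.Ioo 0 1) :
    ∃ Θ : ℝ ≃o ℝ, (∀ t, Θ (t + 1) = Θ t + 1) ∧ Θ 0 = 0 ∧ Θ u = v := by
  have hr : 0 < Real.logb u v := Real.logb_pos_of_base_lt_one hu.1 hu.2 hv.1 hv.2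
  refine ⟨(strictMono_floorRpow hr).orderIsoOfRightInverse _ (floorRpow (Real.logb u v)⁻¹)
    (floorRpow_floorRpow_inv hr), fun _ => floorRpow_add_one, ?_, ?_⟩
  · simp [floorRpow, hr.ne']
  · have hfloor : ⌊u⌋ = 0 := Int.floor_eq_zero_iff.2 ⟨hu.1.le, hu.2⟩
    simp [floorRpow, hfloor, Int.fract, Real.rpow_logb hu.1 hu.2.ne hv.1]

theorem addRight_pow_apply (c : ℝ) (k : ℕ) (t : ℝ) :
    ((OrderIso.addRight c : ℝ ≃o ℝ) ^ k) t = t + k * c := by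
  induction k generalizing t with
  | zero => simp
  | succ k ih =>
    rw [pow_succ, RelIso.mul_apply, ih, OrderIso.addRight_apply]
    push_cast
    ring

theorem addRight_inv_pow {k : ℕ} (hk : k ≠ 0) :
    (OrderIso.addRight (k : ℝ)⁻¹ : ℝ ≃o ℝ) ^ k = OrderIso.addRight 1 := by
  ext t
  simp [addRight_pow_apply, hk]

theorem exists_orderIso_pow_eq_addRight_one {n : ℕ} (hn : 2 ≤ n) {v : ℝ} (hv : v ∈ Set.Ioo 0 1) :
    ∃ Y : ℝ ≃o ℝ, Y ^ n = OrderIso.addRight 1 ∧ Y v = 1 := by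
  have hu : 1 - (n : ℝ)⁻¹ ∈ Set.Ioo (0 : ℝ) 1 :=
    ⟨sub_pos.2 (inv_lt_one_of_one_lt₀ (by exact_mod_cast hn)), sub_lt_self _ (by positivity)⟩
  obtain ⟨Θ, hΘ, hΘ0, hΘv⟩ := exists_orderIso_add_one_apply_eq hu hv
  have hcomm : Θ * OrderIso.addRight 1 * Θ⁻¹ = (OrderIso.addRight 1 : ℝ ≃o ℝ) := by
    rw [mul_inv_eq_iff_eq_mul]
    ext t
    exact hΘ t
  refine ⟨Θ * OrderIso.addRight (n : ℝ)⁻¹ * Θ⁻¹, ?_, ?_⟩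
  · rw [conj_pow, addRight_inv_pow (by omega), hcomm]
  · have hinv : Θ⁻¹ v = 1 - (n : ℝ)⁻¹ := Θ.symm_apply_eq.2 hΘv.symm
    rw [RelIso.mul_apply, RelIso.mul_apply, hinv, OrderIso.addRight_apply, sub_add_cancel]
    simpa [hΘ0] using hΘ 0

end RealLine

/-! ### Torus groups -/

namespace TorusGroup

variable {m n : ℕ}

theorem x_pow_eq_y_pow : x m n ^ m = y m n ^ n := by
  have h : (PresentedGroup.mk
      ({FreeGroup.of 0 ^ m * (FreeGroup.of 1 ^ n)⁻¹} : Set (FreeGroup (Fin 2))))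
      (FreeGroup.of 0 ^ m * (FreeGroup.of 1 ^ n)⁻¹) = 1 :=
    PresentedGroup.one_of_mem rfl
  rw [map_mul, map_inv, map_pow, map_pow, mul_inv_eq_one] at h
  exact h

theorem closure_x_y : Subgroup.closure {x m n, y m n} = ⊤ := by
  rw [← PresentedGroup.closure_range_of]
  congr 1
  ext g
  simp [Set.mem_range, Fin.exists_fin_two, x, y, eq_comm]

/-- The homomorphism determined by a solution of `X ^ m = Y ^ n`. -/
def lift {H : Type*} [Group H] (X Y : H) (h : X ^ m = Y ^ n) : TorusGroup m n →* H :=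
  PresentedGroup.toGroup (f := ![X, Y]) (by
    rintro _ rfl
    simp [h])

theorem lift_x {H : Type*} [Group H] (X Y : H) (h : X ^ m = Y ^ n) : lift X Y h (x m n) = X :=
  PresentedGroup.toGroup.of _

theorem lift_y {H : Type*} [Group H] (X Y : H) (h : X ^ m = Y ^ n) : lift X Y h (y m n) = Y :=
  PresentedGroup.toGroup.of _

theorem s₁_eq : s₁ m n = a m n * b m n := by
  simp [s₁, a, b, mul_assoc]

theorem s₂_eq : s₂ m n = (b m n)⁻¹ := by
  rw [s₂, b, mul_inv_rev, ← zpow_neg]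
  congr 2
  ring

theorem S_eq : S m n = ![a m n * b m n, (b m n)⁻¹] := by
  rw [S, s₁_eq, s₂_eq]

theorem b_mul_a_pow (hm : 1 ≤ m) : b m n * a m n ^ (m - 1) = y m n := by
  rw [b, a, mul_assoc, ← zpow_natCast (x m n), ← zpow_add]
  simp [Nat.cast_sub hm]

theorem closure_a_b (hm : 1 ≤ m) : Subgroup.closure {a m n, b m n} = ⊤ := by
  have ha : a m n ∈ Subgroup.closure {a m n, b m n} := Subgroup.subset_closure (by simp)
  have hb : b m n ∈ Subgroup.closure {a m n, b m n} := Subgroup.subset_closure (by simp)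
  rw [eq_top_iff, ← closure_x_y, Subgroup.closure_le, Set.pair_subset_iff, ← b_mul_a_pow hm]
  exact ⟨ha, mul_mem hb (pow_mem ha _)⟩

theorem range_A : Set.range (A m n) = {a m n, b m n} := by
  simp [A, Set.pair_comm]

theorem range_S : Set.range (S m n) = {a m n * b m n, (b m n)⁻¹} := by
  simp [S_eq, Set.pair_comm]

theorem exists_relation (hm : 2 ≤ m) (hn : 2 ≤ n) (hmn : (m, n) ≠ (2, 2)) :
    ∃ e ∈ halfMonoid (a m n) (b m n), a m n = b m n * a m n * e * a m n * b m n := by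
  refine exists_relation_of_pow_eq (p := m - 1) (q := n - 1) (by omega) (by omega) (by grind) ?_
  rw [b_mul_a_pow (by omega), Nat.sub_add_cancel (by omega), Nat.sub_add_cancel (by omega)]
  exact x_pow_eq_y_pow

theorem one_notMem_halfCone (hm : 2 ≤ m) (hn : 2 ≤ n) :
    (1 : TorusGroup m n) ∉ halfCone (a m n) (b m n) := by
  have hv : (m : ℝ)⁻¹ ∈ Set.Ioo (0 : ℝ) 1 :=
    ⟨by positivity, inv_lt_one_of_one_lt₀ (by exact_mod_cast hm)⟩
  obtain ⟨Y, hY, hYv⟩ := exists_orderIso_pow_eq_addRight_one hn hv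
  have hX := addRight_inv_pow (show m ≠ 0 by omega)
  let φ := lift _ _ (hX.trans hY.symm)
  have hφx : φ (x m n) = OrderIso.addRight (m : ℝ)⁻¹ := lift_x _ _ _
  have hφy : φ (y m n) = Y := lift_y _ _ _
  refine one_notMem_halfCone_of_orderIso φ 1 ?_ ?_
  · have hba : b m n * x m n ^ m = y m n * x m n := by
      rw [← b_mul_a_pow (by omega), a, mul_assoc, pow_sub_one_mul (by omega)]
    have hba0 : φ (b m n * x m n ^ m) 0 = φ (y m n * x m n) 0 := by rw [hba]
    simpa [hφx, hφy, hX, hYv] using hba0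
  · simpa [a, hφx] using hv.1

theorem mem_closure_a_b_or_inv_mem (hm : 1 ≤ m) (hn : 2 ≤ n) (g : TorusGroup m n) :
    g ∈ Submonoid.closure {a m n, b m n} ∨ g⁻¹ ∈ Submonoid.closure {a m n, b m n} :=
  mem_closure_or_inv_mem_closure hm hn x_pow_eq_y_pow (b_mul_a_pow hm) closure_x_y g

theorem isRelCone (hm : 2 ≤ m) (hn : 2 ≤ n) (hmn : (m, n) ≠ (2, 2)) :
    IsRelCone (halfCone (a m n) (b m n)) (b m n) := by
  obtain ⟨e, he, hrel⟩ := exists_relation hm hn hmn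
  have h1 := one_notMem_halfCone hm hn
  exact isRelCone_halfCone h1 (not_isOfFinOrder_right he hrel h1) fun g =>
    (mem_closure_a_b_or_inv_mem (by omega) hn g).imp (closure_pair_le_halfMonoid ·)
      (closure_pair_le_halfMonoid ·)

theorem isDehornoyLike (hQ : IsRelCone (halfCone (a m n) (b m n)) (b m n)) (hm : 1 ≤ m) :
    IsDehornoyLike (S m n) hQ.mul_inv.ordering :=
  ⟨by rw [range_S, closure_mul_inv, closure_a_b hm],
    by rw [hQ.mul_inv.pos_ordering, S_eq, sigmaPositive_pair]⟩

theorem definesIsolated (hQ : IsRelCone (halfCone (a m n) (b m n)) (b m n)) (hm : 1 ≤ m)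
    (hn : 2 ≤ n) : DefinesIsolated (A m n) hQ.ordering := by
  have hA : ∀ i, A m n i ∈ hQ.ordering.pos :=
    Fin.forall_fin_two.2 ⟨hQ.mem_pos_of_mem left_mem_halfCone, hQ.base_mem_pos⟩
  have hpos : hQ.ordering.pos = wordPositive (A m n) :=
    hQ.ordering.pos_eq_wordPositive hA <| by
      simpa only [range_A] using mem_closure_a_b_or_inv_mem hm hn
  exact ⟨by rw [range_A, closure_a_b hm], hpos, hQ.ordering.isIsolated_of_pos_eq_wordPositive hpos⟩

end TorusGroup

theorem corollary3p1_general (m n : ℕ) (hm : 2 ≤ m) (hn : 2 ≤ n) (hmn : (m, n) ≠ (2, 2)) :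
    ∃ D A : LeftOrdering (TorusGroup m n),
      IsDehornoyLike (TorusGroup.S m n) D ∧
      DefinesIsolated (TorusGroup.A m n) A ∧
      (∀ H : Subgroup (TorusGroup m n), D.IsConvex H ↔
        H = ⊥ ∨ H = Subgroup.zpowers (TorusGroup.s₂ m n) ∨ H = ⊤) ∧
      (∀ H : Subgroup (TorusGroup m n), A.IsConvex H ↔
        H = ⊥ ∨ H = Subgroup.zpowers (TorusGroup.b m n) ∨ H = ⊤) ∧
      D.IsConradianSoul (Subgroup.zpowers (TorusGroup.s₂ m n)) ∧
      A.IsConradianSoul (Subgroup.zpowers (TorusGroup.b m n)) ∧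
      AccPt D (𝓟 (Set.range fun g : TorusGroup m n => D.conj g)) ∧
      ¬ D.IsIsolated ∧
      ¬ (Submonoid.closure (sigmaPositive (TorusGroup.S m n))).FG := by
  have hm1 : 1 ≤ m := by omega
  obtain ⟨e, he, hrel⟩ := TorusGroup.exists_relation hm hn hmn
  have hQ := TorusGroup.isRelCone hm hn hmn
  have htop := TorusGroup.closure_a_b (n := n) hm1
  have htop' := closure_mul_inv.trans htop
  have hsoul := exists_inv_mul_mul_sq_inv_mem_halfCone he hrel
  have hD := TorusGroup.isDehornoyLike hQ hm1
  have hacc := accPt_conj_of_relation hQ he hrel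
  have hiso := LeftOrdering.not_isIsolated_of_accPt _ hacc
  rw [TorusGroup.s₂_eq]
  exact ⟨_, hQ.ordering, hD, TorusGroup.definesIsolated hQ hm1 hn,
    isConvex_ordering_halfCone_iff hQ.mul_inv htop', isConvex_ordering_halfCone_iff hQ htop,
    isConradianSoul_ordering_halfCone hQ.mul_inv htop' (by rwa [halfCone_mul_inv]),
    isConradianSoul_ordering_halfCone hQ htop hsoul, hacc, hiso,
    hD.2 ▸ LeftOrdering.not_fg_closure_pos _ hiso⟩

theorem corollary3p1 (m n : ℕ) (hn : 2 ≤ n) (hnm : n ≤ m) (hmn : (m, n) ≠ (2, 2)) :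
    ∃ D A : LeftOrdering (TorusGroup m n),
      IsDehornoyLike (TorusGroup.S m n) D ∧
      DefinesIsolated (TorusGroup.A m n) A ∧
      (∀ H : Subgroup (TorusGroup m n), D.IsConvex H ↔
        H = ⊥ ∨ H = Subgroup.zpowers (TorusGroup.s₂ m n) ∨ H = ⊤) ∧
      (∀ H : Subgroup (TorusGroup m n), A.IsConvex H ↔
        H = ⊥ ∨ H = Subgroup.zpowers (TorusGroup.b m n) ∨ H = ⊤) ∧
      D.IsConradianSoul (Subgroup.zpowers (TorusGroup.s₂ m n)) ∧
      A.IsConradianSoul (Subgroup.zpowers (TorusGroup.b m n)) ∧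
      AccPt D (𝓟 (Set.range fun g : TorusGroup m n => D.conj g)) ∧
      ¬ D.IsIsolated ∧
      ¬ (Submonoid.closure (sigmaPositive (TorusGroup.S m n))).FG :=
  corollary3p1_general m n (hn.trans hnm) hn hmn
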